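/- For $d \ge 0$ let $G_4(d)$ be the tetrahedral grid graph: its vertices are the monomials of degree $d$ in the four variables $x_1, x_2, x_3, x_4$, and two monomials $f, g$ are adjacent if and only if $\operatorname{lcm}(f,g)$ has degree $d+1$. A maximum independent set of a graph is an independent set of vertices of the largest possible size. If $d \equiv 0 \pmod 2$, then $G_4(d)$ has exactly one maximum independent set. -/

import Mathlib

/-- The monomials of degree `d` in the `n` variables `x_0, …, x_{n-1}`; as in `MvPolynomial`,
a monomial is given by its exponent vector `Fin n →₀ ℕ`. -/
abbrev MonomialOfDegree (n d : ℕ) : Type :=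
  {m : Fin n →₀ ℕ // m.degree = d}

instance MonomialOfDegree.instFinite (n d : ℕ) : Finite (MonomialOfDegree n d) := by
  have h : ∀ (m : MonomialOfDegree n d) (i : Fin n), m.1 i < d + 1 := fun m i =>
    Nat.lt_succ_of_le ((Finsupp.le_degree i m.1).trans m.2.le)
  refine Finite.of_injective
    (fun (m : MonomialOfDegree n d) (i : Fin n) => (⟨m.1 i, h m i⟩ : Fin (d + 1))) ?_
  intro a b hab
  apply Subtype.ext
  ext i
  exact congrArg Fin.val (congrFun hab i)

/-- The graph `G_n(d)` on the monomials of degree `d` in `n` variables: two monomials are adjacent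
when their least common multiple has degree `d + 1`. In terms of exponent vectors the least common
multiple is the pointwise maximum `⊔`. -/
def monomialGraph (n d : ℕ) : SimpleGraph (MonomialOfDegree n d) where
  Adj f g := (f.1 ⊔ g.1).degree = d + 1
  symm := ⟨fun f g h => by rwa [sup_comm]⟩
  loopless := ⟨fun f h => by
    rw [sup_idem, f.2] at h
    omega⟩

/-- The number of maximum independent sets of `G_n(d)`. -/
noncomputable def numMaximumIndepSets (n d : ℕ) : ℕ :=
  Set.ncard {I : Finset (MonomialOfDegree n d) | (monomialGraph n d).IsMaximumIndepSet I}

open Finset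

/-! The unique maximum independent set is the set S of monomials whose exponents all have the same
parity. A fractional clique cover certifies this: the weights `cliqueWeight` cover each vertex
exactly once, and S meets every clique of positive weight. By complementary slackness
(`exists_mem_of_fractional_clique_cover`), so does any independent I with at least as many elements
as S. This forces all squares into I (`mem_of_even_exponents`). As d is even, a monomial outside S
has exactly two odd exponents, hence is adjacent to a square, so I lies in S and equals it by
cardinality. -/

/-! ### Complementary slackness -/

/-- Let every vertex `v` lie in the cliques `c v i`, where the cliques carry nonnegative weights such
that each vertex is covered with total weight `1`. If every clique of positive weight meets `S`, then
every such clique meets every independent set that is at least as large as `S`. -/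
theorem exists_mem_of_fractional_clique_cover {V ι κ : Type*} [Fintype V] [Fintype ι]
    (G : SimpleGraph V) (c : V → ι → κ) (w : κ → ℚ)
    (hinj : ∀ v, Function.Injective (c v))
    (hadj : ∀ u v i j, u ≠ v → c u i = c v j → G.Adj u v)
    (hw : ∀ v i, 0 ≤ w (c v i)) (hsum : ∀ v, ∑ i, w (c v i) = 1)
    (S I : Finset V) (hS : ∀ v i, 0 < w (c v i) → ∃ s ∈ S, ∃ j, c s j = c v i)
    (hI : G.IsIndepSet I) (hcard : #S ≤ #I) (v : V) (i : ι) (hpos : 0 < w (c v i)) :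
    ∃ u ∈ I, ∃ j, c u j = c v i := by
  classical
  let T : Finset κ := (univ : Finset (V × ι)).image fun p => c p.1 p.2
  let N : Finset V → κ → Finset (V × ι) := fun A C =>
    (A ×ˢ (univ : Finset ι)).filter fun p => c p.1 p.2 = C
  -- Double counting of incidences between A and the cliques.
  have hcount (A : Finset V) : (#A : ℚ) = ∑ C ∈ T, #(N A C) * w C := by
    calc (#A : ℚ) = ∑ u ∈ A, ∑ j, w (c u j) := by simp [hsum]
      _ = ∑ p ∈ A ×ˢ (univ : Finset ι), w (c p.1 p.2) :=
        (sum_product A univ fun p : V × ι => w (c p.1 p.2)).symm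
      _ = ∑ C ∈ T, ∑ p ∈ N A C, w (c p.1 p.2) :=
        (sum_fiberwise_of_maps_to (fun p _ => mem_image_of_mem _ (mem_univ p)) _).symm
      _ = ∑ C ∈ T, #(N A C) * w C := by
        refine sum_congr rfl fun C _ => ?_
        rw [sum_congr rfl fun p hp => by rw [(mem_filter.1 hp).2], sum_const, nsmul_eq_mul]
  have hT : ∀ C ∈ T, 0 ≤ w C := by
    intro C hC
    obtain ⟨p, -, rfl⟩ := mem_image.1 hC
    exact hw _ _
  have hNS : ∀ C ∈ T, w C ≤ #(N S C) * w C := by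
    intro C hC
    rcases (hT C hC).eq_or_lt with h0 | h0
    · simp [← h0]
    obtain ⟨p, -, rfl⟩ := mem_image.1 hC
    obtain ⟨s, hs, j, hj⟩ := hS p.1 p.2 h0
    have : 0 < #(N S (c p.1 p.2)) := card_pos.2 ⟨(s, j), by simp [N, hs, hj]⟩
    exact le_mul_of_one_le_left h0.le (by exact_mod_cast this)
  have hNI : ∀ C ∈ T, #(N I C) * w C ≤ w C := by
    intro C hC
    have : #(N I C) ≤ 1 := by
      refine card_le_one.2 ?_
      rintro ⟨u, j⟩ hu ⟨u', j'⟩ hu'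
      simp only [N, mem_filter, mem_product, mem_univ, and_true] at hu hu'
      have huu : u = u' := by
        by_contra hne
        exact hI hu.1 hu'.1 hne (hadj u u' j j' hne (hu.2.trans hu'.2.symm))
      subst huu
      rw [hinj u (hu.2.trans hu'.2.symm)]
    exact mul_le_of_le_one_left (hT C hC) (by exact_mod_cast this)
  have hle : ∑ C ∈ T, w C ≤ ∑ C ∈ T, #(N I C) * w C := by
    rw [← hcount I]
    exact (sum_le_sum hNS).trans (by rw [← hcount S]; exact_mod_cast hcard)
  -- The total weight is at most #S, and #I is at most the total weight, so equality holds clique by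
  -- clique.
  have heq := (sum_eq_sum_iff_of_le hNI).1 (le_antisymm (sum_le_sum hNI) hle) (c v i)
    (mem_image_of_mem (fun p : V × ι => c p.1 p.2) (mem_univ (v, i)))
  have hne : (N I (c v i)).Nonempty := by
    rw [nonempty_iff_ne_empty]
    intro h
    rw [h] at heq
    simp only [card_empty, Nat.cast_zero, zero_mul] at heq
    exact hpos.ne heq
  obtain ⟨⟨u, j⟩, hu⟩ := hne
  simp only [N, mem_filter, mem_product, mem_univ, and_true] at hu
  exact ⟨u, hu.1, j, hu.2⟩

/-! ### Exponent vectors and the two kinds of cliques -/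

namespace MonomialOfDegree

/-- The exponent vector of a monomial, with integer entries. -/
def exponents {n d : ℕ} (v : MonomialOfDegree n d) : Fin n → ℤ := fun i => (v.1 i : ℤ)

theorem exponents_nonneg {n d : ℕ} (v : MonomialOfDegree n d) (i : Fin n) : 0 ≤ v.exponents i :=
  Int.natCast_nonneg _

theorem exponents_injective {n d : ℕ} :
    Function.Injective (exponents : MonomialOfDegree n d → Fin n → ℤ) := by
  intro u v h
  apply Subtype.ext
  ext i
  exact Int.ofNat_inj.1 (congrFun h i)

theorem sum_exponents {n d : ℕ} (v : MonomialOfDegree n d) : ∑ i, v.exponents i = d := by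
  have h := v.2
  rw [Finsupp.degree_eq_sum] at h
  simp only [exponents]
  exact_mod_cast h

theorem exists_exponents_eq {n d : ℕ} (f : Fin n → ℤ) (hf : ∀ i, 0 ≤ f i) (hsum : ∑ i, f i = d) :
    ∃ v : MonomialOfDegree n d, v.exponents = f := by
  refine ⟨⟨Finsupp.equivFunOnFinite.symm fun i => (f i).toNat, ?_⟩, ?_⟩
  · rw [Finsupp.degree_eq_sum]
    zify
    simpa [hf] using hsum
  · ext i
    simp [exponents, hf]

theorem adj_of_exponents_add_single_eq {n d : ℕ} {u v : MonomialOfDegree n d} {i j : Fin n}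
    (huv : u ≠ v) (h : u.exponents + Pi.single i 1 = v.exponents + Pi.single j 1) :
    (monomialGraph n d).Adj u v := by
  have hij : i ≠ j := by
    rintro rfl
    exact huv (exponents_injective (add_right_cancel h))
  have hsup : u.1 ⊔ v.1 = u.1 + Finsupp.single i 1 := by
    ext l
    have hl := congrFun h l
    simp only [exponents, Pi.add_apply, Pi.single_apply] at hl
    simp only [Finsupp.sup_apply, Finsupp.add_apply, Finsupp.single_apply, eq_comm (a := i)]
    by_cases h1 : l = i
    · have h2 : l ≠ j := fun h2 => hij (h1.symm.trans h2)
      simp only [h1, h1 ▸ h2, if_true, if_false] at hl ⊢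
      omega
    · simp only [h1, if_false] at hl ⊢
      split_ifs at hl <;> omega
  change (u.1 ⊔ v.1).degree = d + 1
  rw [hsup, map_add, u.2, Finsupp.degree_single]

/-- The eight cliques containing `v`, encoded by monomials of neighbouring degree: `(true, m)` stands
for the multiples of `m` and `(false, m)` for the divisors of `m` (an exponent `-1` may occur in `m`;
such cliques get weight `0`). -/
def incidentClique {d : ℕ} (v : MonomialOfDegree 4 d) (p : Bool × Fin 4) : Bool × (Fin 4 → ℤ) :=
  (p.1, if p.1 then v.exponents - Pi.single p.2 1 else v.exponents + Pi.single p.2 1)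

theorem incidentClique_injective {d : ℕ} (v : MonomialOfDegree 4 d) :
    Function.Injective v.incidentClique := by
  rintro ⟨b, i⟩ ⟨b', i'⟩ h
  obtain rfl : b = b' := congrArg Prod.fst h
  have h2 := congrArg Prod.snd h
  have hs : (Pi.single i 1 : Fin 4 → ℤ) = Pi.single i' 1 := by
    cases b <;> simpa [incidentClique] using h2
  have := congrFun hs i
  rw [Pi.single_eq_same, Pi.single_apply] at this
  split_ifs at this with hi
  · rw [hi]
  · omega

theorem adj_of_incidentClique_eq {d : ℕ} (u v : MonomialOfDegree 4 d) (p q : Bool × Fin 4)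
    (huv : u ≠ v) (h : u.incidentClique p = v.incidentClique q) :
    (monomialGraph 4 d).Adj u v := by
  obtain ⟨b, i⟩ := p
  obtain ⟨b', j⟩ := q
  obtain rfl : b = b' := congrArg Prod.fst h
  have h2 := congrArg Prod.snd h
  cases b
  · exact adj_of_exponents_add_single_eq (i := i) (j := j) huv (by simpa [incidentClique] using h2)
  · refine adj_of_exponents_add_single_eq (i := j) (j := i) huv ?_
    simp only [incidentClique, if_true] at h2
    rw [sub_eq_sub_iff_add_eq_add] at h2
    exact h2

/-! ### The fractional clique cover -/

/-- The weights of the cliques of multiples. -/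
def multiplesWeight (a b c e : ℤ) : ℚ :=
  if e % 2 = 0 then
    (if a % 2 = 0 then (if b % 2 = 0 then c + 1 else if c % 2 = 0 then b + 1 else 0)
      else if b % 2 = 0 ∧ c % 2 = 0 then a + 1 else 0 : ℚ) / (a + b + c + 3)
  else 0

/-- The weights of the cliques of divisors. -/
def divisorsWeight (a b c e : ℤ) : ℚ :=
  if e % 2 = 0 then 0
  else (if a % 2 = 0 then (if b % 2 = 0 then 2 else a) else if b % 2 = 0 then b else c : ℚ) /
    (a + b + c + 2)

/-- A weighting of the cliques that covers each monomial of even degree exactly once. It respects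
the partition of the monomials into the slabs `{v | v 3 ∈ {2 * j, 2 * j + 1}}`. -/
def cliqueWeight (C : Bool × (Fin 4 → ℤ)) : ℚ :=
  if C.1 then multiplesWeight (C.2 0) (C.2 1) (C.2 2) (C.2 3)
  else divisorsWeight (C.2 0) (C.2 1) (C.2 2) (C.2 3)

/-- Only four of the eight terms can be nonzero for a given parity of e, and they share one
denominator: a + b + c + 2 for e even, a + b + c + 3 for e odd. The numerators add up to it in each
parity class. -/
theorem sum_weights_eq_one (a b c e : ℤ) (ha : 0 ≤ a) (hb : 0 ≤ b) (hc : 0 ≤ c)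
    (h : (a + b + c + e) % 2 = 0) :
    multiplesWeight (a - 1) b c e + multiplesWeight a (b - 1) c e + multiplesWeight a b (c - 1) e +
      multiplesWeight a b c (e - 1) + divisorsWeight (a + 1) b c e + divisorsWeight a (b + 1) c e +
      divisorsWeight a b (c + 1) e + divisorsWeight a b c (e + 1) = 1 := by
  have ha' : (0 : ℚ) ≤ a := by exact_mod_cast ha
  have hb' : (0 : ℚ) ≤ b := by exact_mod_cast hb
  have hc' : (0 : ℚ) ≤ c := by exact_mod_cast hc
  have h2 : (a + b + c + 2 : ℚ) ≠ 0 := by positivity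
  have h3 : (a + b + c + 3 : ℚ) ≠ 0 := by positivity
  have e1 (x : ℤ) : x % 2 = 0 → (x + 1) % 2 = 1 ∧ (x - 1) % 2 = 1 := by omega
  have e2 (x : ℤ) : x % 2 = 1 → (x + 1) % 2 = 0 ∧ (x - 1) % 2 = 0 := by omega
  have q1 : ((a - 1 : ℤ) + b + c + 3 : ℚ) = a + b + c + 2 := by push_cast; ring
  have q2 : (a + (b - 1 : ℤ) + c + 3 : ℚ) = a + b + c + 2 := by push_cast; ring
  have q3 : (a + b + (c - 1 : ℤ) + 3 : ℚ) = a + b + c + 2 := by push_cast; ring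
  have r1 : ((a + 1 : ℤ) + b + c + 2 : ℚ) = a + b + c + 3 := by push_cast; ring
  have r2 : (a + (b + 1 : ℤ) + c + 2 : ℚ) = a + b + c + 3 := by push_cast; ring
  have r3 : (a + b + (c + 1 : ℤ) + 2 : ℚ) = a + b + c + 3 := by push_cast; ring
  unfold multiplesWeight divisorsWeight
  rw [q1, q2, q3, r1, r2, r3]
  rcases Int.emod_two_eq_zero_or_one a with pa | pa <;>
  rcases Int.emod_two_eq_zero_or_one b with pb | pb <;>
  rcases Int.emod_two_eq_zero_or_one c with pc | pc <;>
  rcases Int.emod_two_eq_zero_or_one e with pe | pe <;>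
  first
  | (exfalso; omega)
  | (simp [pa, pb, pc, pe, e1, e2]
     field_simp
     try ring)

theorem sum_cliqueWeight {d : ℕ} (hd : d % 2 = 0) (v : MonomialOfDegree 4 d) :
    ∑ p, cliqueWeight (v.incidentClique p) = 1 := by
  have hs := v.sum_exponents
  rw [Fin.sum_univ_four] at hs
  have h := sum_weights_eq_one (v.exponents 0) (v.exponents 1) (v.exponents 2) (v.exponents 3)
    (v.exponents_nonneg 0) (v.exponents_nonneg 1) (v.exponents_nonneg 2) (by omega)
  rw [Fintype.sum_prod_type, Fintype.sum_bool, Fin.sum_univ_four, Fin.sum_univ_four, ← h]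
  simp [cliqueWeight, incidentClique]
  ring

theorem multiplesWeight_nonneg {a b c e : ℤ} (ha : -1 ≤ a) (hb : -1 ≤ b) (hc : -1 ≤ c) :
    0 ≤ multiplesWeight a b c e := by
  have ha' : (-1 : ℚ) ≤ a := by exact_mod_cast ha
  have hb' : (-1 : ℚ) ≤ b := by exact_mod_cast hb
  have hc' : (-1 : ℚ) ≤ c := by exact_mod_cast hc
  unfold multiplesWeight
  split_ifs <;> first | exact le_rfl | exact div_nonneg (by linarith) (by linarith)

theorem divisorsWeight_nonneg {a b c e : ℤ} (ha : 0 ≤ a) (hb : 0 ≤ b) (hc : 0 ≤ c) :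
    0 ≤ divisorsWeight a b c e := by
  have ha' : (0 : ℚ) ≤ a := by exact_mod_cast ha
  have hb' : (0 : ℚ) ≤ b := by exact_mod_cast hb
  have hc' : (0 : ℚ) ≤ c := by exact_mod_cast hc
  unfold divisorsWeight
  split_ifs <;> first | exact le_rfl | positivity

theorem cliqueWeight_nonneg {d : ℕ} (v : MonomialOfDegree 4 d) (p : Bool × Fin 4) :
    0 ≤ cliqueWeight (v.incidentClique p) := by
  obtain ⟨b, i⟩ := p
  have hs (l : Fin 4) : (0 : ℤ) ≤ (Pi.single i 1 : Fin 4 → ℤ) l ∧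
      (Pi.single i 1 : Fin 4 → ℤ) l ≤ 1 := by
    rw [Pi.single_apply]
    split_ifs <;> simp
  have hv (l : Fin 4) := v.exponents_nonneg l
  cases b
  · simp only [cliqueWeight, incidentClique, Bool.false_eq_true, if_false, Pi.add_apply]
    apply divisorsWeight_nonneg <;> linarith [hs 0, hs 1, hs 2, hv 0, hv 1, hv 2]
  · simp only [cliqueWeight, incidentClique, if_true, Pi.sub_apply]
    apply multiplesWeight_nonneg <;> linarith [hs 0, hs 1, hs 2, hv 0, hv 1, hv 2]

/-! ### Equiparity monomials: independent, and meeting every positive clique -/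

/-- The exponents of the monomial are all even or all odd. -/
def IsEquiparity {d : ℕ} (v : MonomialOfDegree 4 d) : Prop :=
  ∀ i, v.exponents i % 2 = v.exponents 0 % 2

/-- The differences of exponents of adjacent monomials are 1, -1, 0, 0 in some order, which have
mixed parity. -/
theorem not_adj_of_isEquiparity {d : ℕ} {u v : MonomialOfDegree 4 d} (hu : u.IsEquiparity)
    (hv : v.IsEquiparity) : ¬ (monomialGraph 4 d).Adj u v := by
  have key (x y z t : ℤ) (h0 : x + y + z + t = 0) (hy : (y - x) % 2 = 0) (hz : (z - x) % 2 = 0)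
      (ht : (t - x) % 2 = 0) (h : max x 0 + max y 0 + max z 0 + max t 0 = 1) : False := by
    rcases le_total x 0 with h1 | h1 <;> rcases le_total y 0 with h2 | h2 <;>
    rcases le_total z 0 with h3 | h3 <;> rcases le_total t 0 with h4 | h4 <;>
    simp only [h1, h2, h3, h4, max_eq_left, max_eq_right] at h <;> omega
  intro h
  have h : (u.1 ⊔ v.1).degree = d + 1 := h
  have h1 := u.sum_exponents
  have h2 := v.sum_exponents
  rw [Finsupp.degree_eq_sum, Fin.sum_univ_four] at h
  rw [Fin.sum_univ_four] at h1 h2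
  simp only [Finsupp.sup_apply] at h
  have hm (i : Fin 4) : max (u.exponents i - v.exponents i) 0 =
      (max (u.1 i) (v.1 i) : ℕ) - v.exponents i := by
    simp only [exponents]
    omega
  have hpar (i : Fin 4) :
      (u.exponents i - v.exponents i - (u.exponents 0 - v.exponents 0)) % 2 = 0 := by
    have := hu i
    have := hv i
    omega
  refine key _ _ _ _ ?_ (hpar 1) (hpar 2) (hpar 3) ?_
  · linarith
  · rw [hm, hm, hm, hm]
    zify at h
    push_cast
    linarith

theorem exists_incidentClique_eq {d : ℕ} (f : Fin 4 → ℤ) (b : Bool) (j : Fin 4)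
    (hf : ∀ i, 0 ≤ f i + (Pi.single j (if b then 1 else -1) : Fin 4 → ℤ) i)
    (hpar : ∀ i, (f i + (Pi.single j (if b then 1 else -1) : Fin 4 → ℤ) i) % 2 =
      (f 0 + (Pi.single j (if b then 1 else -1) : Fin 4 → ℤ) 0) % 2)
    (hsum : ∑ i, f i = if b then (d : ℤ) - 1 else d + 1) :
    ∃ s : MonomialOfDegree 4 d, s.IsEquiparity ∧ s.incidentClique (b, j) = (b, f) := by
  obtain ⟨s, hs⟩ := exists_exponents_eq (d := d) _ hf (by
    cases b <;> simp [sum_add_distrib, hsum])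
  refine ⟨s, by rwa [IsEquiparity, hs], ?_⟩
  cases b
  · ext i
    · simp [incidentClique]
    · by_cases hij : i = j <;> simp [incidentClique, hs, Pi.single_apply, hij]
  · ext i
    · simp [incidentClique]
    · by_cases hij : i = j <;> simp [incidentClique, hs, Pi.single_apply, hij]

theorem exists_isEquiparity_of_multiplesWeight_pos {d : ℕ} (hd : d % 2 = 0) (f : Fin 4 → ℤ)
    (hf : ∀ i, -1 ≤ f i) (hsum : ∑ i, f i = (d : ℤ) - 1)
    (h : 0 < multiplesWeight (f 0) (f 1) (f 2) (f 3)) :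
    ∃ s : MonomialOfDegree 4 d, s.IsEquiparity ∧ ∃ j, s.incidentClique (true, j) = (true, f) := by
  suffices ∃ j, ∀ i, 0 ≤ f i + (Pi.single j 1 : Fin 4 → ℤ) i ∧
      (f i + (Pi.single j 1 : Fin 4 → ℤ) i) % 2 = 0 by
    obtain ⟨j, hj⟩ := this
    obtain ⟨s, hs, hs'⟩ := exists_incidentClique_eq (d := d) f true j
      (fun i => by simpa using (hj i).1) (fun i => by simp only [if_true]; rw [(hj i).2, (hj 0).2])
      (by simpa using hsum)
    exact ⟨s, hs, j, hs'⟩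
  rw [Fin.sum_univ_four] at hsum
  have f0 := hf 0
  have f1 := hf 1
  have f2 := hf 2
  have f3 := hf 3
  unfold multiplesWeight at h
  split_ifs at h with pe pa pb pc pbc
  -- Positive weight leaves exactly one odd exponent; multiplying by that variable gives a square,
  -- and an exponent -1 becomes 0.
  · refine ⟨2, fun i => ?_⟩
    fin_cases i <;> simp <;> omega
  · refine ⟨1, fun i => ?_⟩
    fin_cases i <;> simp <;> omega
  · simp at h
  · refine ⟨0, fun i => ?_⟩
    fin_cases i <;> simp <;> omega
  · simp at h
  · simp at h

theorem exists_isEquiparity_of_divisorsWeight_pos {d : ℕ} (hd : d % 2 = 0) (f : Fin 4 → ℤ)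
    (hf : ∀ i, 0 ≤ f i) (hsum : ∑ i, f i = (d : ℤ) + 1)
    (h : 0 < divisorsWeight (f 0) (f 1) (f 2) (f 3)) :
    ∃ s : MonomialOfDegree 4 d, s.IsEquiparity ∧ ∃ j, s.incidentClique (false, j) = (false, f) := by
  suffices ∃ j, ∀ i, 0 ≤ f i + (Pi.single j (-1) : Fin 4 → ℤ) i ∧
      (f i + (Pi.single j (-1) : Fin 4 → ℤ) i) % 2 =
        (f 0 + (Pi.single j (-1) : Fin 4 → ℤ) 0) % 2 by
    obtain ⟨j, hj⟩ := this
    obtain ⟨s, hs, hs'⟩ := exists_incidentClique_eq (d := d) f false j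
      (fun i => by simpa using (hj i).1) (fun i => by simpa using (hj i).2) (by simpa using hsum)
    exact ⟨s, hs, j, hs'⟩
  rw [Fin.sum_univ_four] at hsum
  have f0 := hf 0
  have f1 := hf 1
  have f2 := hf 2
  have f3 := hf 3
  have hne (x : ℤ) (y : ℚ) (hx : 0 < (x : ℚ) / y) : x ≠ 0 := by
    rintro rfl
    simp at hx
  unfold divisorsWeight at h
  split_ifs at h with pe pa pb pb
  · simp at h
  -- Only the last exponent is odd, so dividing by that variable gives a square.
  · refine ⟨3, fun i => ?_⟩
    fin_cases i <;> simp <;> omega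
  -- Here exactly one exponent is even. The weight makes it nonzero, so dividing by its variable
  -- leaves all exponents odd and nonnegative.
  · have := hne _ _ h
    refine ⟨0, fun i => ?_⟩
    fin_cases i <;> simp <;> omega
  · have := hne _ _ h
    refine ⟨1, fun i => ?_⟩
    fin_cases i <;> simp <;> omega
  · have := hne _ _ h
    refine ⟨2, fun i => ?_⟩
    fin_cases i <;> simp <;> omega

theorem exists_isEquiparity_of_cliqueWeight_pos {d : ℕ} (hd : d % 2 = 0)
    (v : MonomialOfDegree 4 d) (p : Bool × Fin 4) (h : 0 < cliqueWeight (v.incidentClique p)) :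
    ∃ s : MonomialOfDegree 4 d, s.IsEquiparity ∧ ∃ q, s.incidentClique q = v.incidentClique p := by
  obtain ⟨b, i⟩ := p
  have hs (l : Fin 4) : (0 : ℤ) ≤ (Pi.single i 1 : Fin 4 → ℤ) l ∧
      (Pi.single i 1 : Fin 4 → ℤ) l ≤ 1 := by
    rw [Pi.single_apply]
    split_ifs <;> simp
  have hv (l : Fin 4) := v.exponents_nonneg l
  cases b
  · obtain ⟨s, hs, j, hj⟩ := exists_isEquiparity_of_divisorsWeight_pos hd
      (v.exponents + Pi.single i 1) (fun l => add_nonneg (hv l) (hs l).1)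
      (by simp [sum_add_distrib, sum_exponents]) (by simpa [cliqueWeight, incidentClique] using h)
    exact ⟨s, hs, _, by rw [hj]; simp [incidentClique]⟩
  · obtain ⟨s, hs, j, hj⟩ := exists_isEquiparity_of_multiplesWeight_pos hd
      (v.exponents - Pi.single i 1)
      (fun l => by have := hv l; have := (hs l).2; simp only [Pi.sub_apply]; omega)
      (by simp [sum_exponents]) (by simpa [cliqueWeight, incidentClique] using h)
    exact ⟨s, hs, _, by rw [hj]; simp [incidentClique]⟩

/-! ### Rigidity of the maximum independent set -/

/-- If an independent set meets every clique of positive weight, then it contains all monomials that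
are squares. -/
theorem mem_of_even_exponents {d : ℕ} (I : Finset (MonomialOfDegree 4 d))
    (hI : (monomialGraph 4 d).IsIndepSet I)
    (hmeet : ∀ (v : MonomialOfDegree 4 d) p, 0 < cliqueWeight (v.incidentClique p) →
      ∃ u ∈ I, ∃ q, u.incidentClique q = v.incidentClique p)
    (s : MonomialOfDegree 4 d) (hs : ∀ i, s.exponents i % 2 = 0) : s ∈ I := by
  have hle (v : MonomialOfDegree 4 d) : v.exponents 3 ≤ d := by
    have h := v.sum_exponents
    rw [Fin.sum_univ_four] at h
    linarith [v.exponents_nonneg 0, v.exponents_nonneg 1, v.exponents_nonneg 2]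
  -- Downward induction on the exponent of x_3.
  induction hk : (d - s.exponents 3).toNat using Nat.strong_induction_on generalizing s with
  | _ k ih =>
    have h0 : (0 : ℚ) ≤ s.exponents 0 := by exact_mod_cast s.exponents_nonneg 0
    have h1 : (0 : ℚ) ≤ s.exponents 1 := by exact_mod_cast s.exponents_nonneg 1
    have h2 : (0 : ℚ) ≤ s.exponents 2 := by exact_mod_cast s.exponents_nonneg 2
    have h3 : (s.exponents 3 + 1) % 2 ≠ 0 := by
      have := hs 3
      omega
    -- The divisors of s x_3 form a clique of positive weight (numerator 2), so I contains some u =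
    -- s x_3 / x_i.
    obtain ⟨u, hu, ⟨b, i⟩, hui⟩ := hmeet s (false, 3) (by
      simp only [cliqueWeight, incidentClique, divisorsWeight]
      simp [hs, h3]
      positivity)
    obtain rfl : b = false := congrArg Prod.fst hui
    have hui : u.exponents + Pi.single i 1 = s.exponents + Pi.single 3 1 := by
      simpa [incidentClique] using hui
    by_cases hi : i = 3
    · rw [hi] at hui
      rwa [← exponents_injective (add_right_cancel hui)]
    have hsi : 2 ≤ s.exponents i := by
      have h := congrFun hui i
      simp only [Pi.add_apply, Pi.single_eq_same, Pi.single_eq_of_ne hi] at h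
      have := u.exponents_nonneg i
      have := hs i
      omega
    -- If i ≠ 3, the square t = s x_3^2 / x_i^2 is in I by induction, yet t x_i = u x_3 makes it
    -- adjacent to u.
    obtain ⟨t, ht⟩ := exists_exponents_eq (d := d)
      (s.exponents + Pi.single 3 2 - Pi.single i 2) (fun l => by
        have := s.exponents_nonneg l
        simp only [Pi.add_apply, Pi.sub_apply, Pi.single_apply]
        by_cases hl : l = i
        · rw [hl] at this ⊢
          simp only [hi, if_true, if_false]
          omega
        · simp only [hl, if_false]
          split_ifs <;> omega) (by simp [sum_add_distrib, sum_exponents])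
    have ht3 : t.exponents 3 = s.exponents 3 + 2 := by
      rw [ht]
      simp [Ne.symm hi]
    have htI : t ∈ I := by
      refine ih _ ?_ t (fun l => ?_) rfl
      · have := hle t
        omega
      · have := hs l
        rw [ht]
        simp only [Pi.add_apply, Pi.sub_apply, Pi.single_apply]
        split_ifs <;> omega
    have hu3 : u.exponents 3 = s.exponents 3 + 1 := by
      simpa [Pi.single_apply, Ne.symm hi] using congrFun hui 3
    have hut : u ≠ t := by
      rintro rfl
      omega
    refine absurd (adj_of_exponents_add_single_eq (i := 3) (j := i) hut ?_) (hI hu htI hut)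
    ext l
    have h := congrFun hui l
    rw [ht]
    simp only [Pi.add_apply, Pi.sub_apply, Pi.single_apply] at h ⊢
    split_ifs at h ⊢ <;> omega

theorem isEquiparity_of_mem {d : ℕ} (hd : d % 2 = 0) (I : Finset (MonomialOfDegree 4 d))
    (hI : (monomialGraph 4 d).IsIndepSet I)
    (hsq : ∀ s : MonomialOfDegree 4 d, (∀ i, s.exponents i % 2 = 0) → s ∈ I)
    (v : MonomialOfDegree 4 d) (hv : v ∈ I) : v.IsEquiparity := by
  have key (i j : Fin 4) (hi : v.exponents i % 2 = 1) (hj : v.exponents j % 2 = 1) (hij : i ≠ j)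
      (hl : ∀ l, l ≠ i → l ≠ j → v.exponents l % 2 = 0) : False := by
    -- With only i and j odd, v x_i / x_j is a square adjacent to v.
    obtain ⟨t, ht⟩ := exists_exponents_eq (d := d)
      (v.exponents + Pi.single i 1 - Pi.single j 1) (fun l => by
        have := v.exponents_nonneg l
        simp only [Pi.add_apply, Pi.sub_apply, Pi.single_apply]
        by_cases hlj : l = j
        · rw [hlj] at this ⊢
          split_ifs <;> omega
        · simp only [hlj, if_false]
          split_ifs <;> omega) (by simp [sum_add_distrib, sum_exponents])
    have htI : t ∈ I := hsq t fun l => by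
      rw [ht]
      simp only [Pi.add_apply, Pi.sub_apply, Pi.single_apply]
      by_cases hli : l = i
      · have : l ≠ j := fun h => hij (hli.symm.trans h)
        simp only [hli, hij, if_true, if_false]
        omega
      · by_cases hlj : l = j
        · simp only [hlj, hij.symm, if_true, if_false]
          omega
        · simp [hli, hlj, hl l hli hlj]
    have hvt : v ≠ t := by
      rintro rfl
      have := congrFun ht i
      simp [hij] at this
    exact hI hv htI hvt (adj_of_exponents_add_single_eq (i := i) (j := j) hvt (by rw [ht]; abel))
  have hs := v.sum_exponents
  rw [Fin.sum_univ_four] at hs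
  have hpair (i j : Fin 4) (hij : i ≠ j) : ¬ (v.exponents i % 2 = 1 ∧ v.exponents j % 2 = 1 ∧
      ∀ l, l ≠ i → l ≠ j → v.exponents l % 2 = 0) := fun h => key i j h.1 h.2.1 hij h.2.2
  have h01 := hpair 0 1 (by decide)
  have h02 := hpair 0 2 (by decide)
  have h03 := hpair 0 3 (by decide)
  have h12 := hpair 1 2 (by decide)
  have h13 := hpair 1 3 (by decide)
  have h23 := hpair 2 3 (by decide)
  simp [Fin.forall_fin_succ] at h01 h02 h03 h12 h13 h23
  intro i
  rcases Int.emod_two_eq_zero_or_one (v.exponents 0) with p0 | p0 <;>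
  rcases Int.emod_two_eq_zero_or_one (v.exponents 1) with p1 | p1 <;>
  rcases Int.emod_two_eq_zero_or_one (v.exponents 2) with p2 | p2 <;>
  rcases Int.emod_two_eq_zero_or_one (v.exponents 3) with p3 | p3 <;>
  first
  | (exfalso; omega)
  | (fin_cases i <;> simp [p0, p1, p2, p3])

end MonomialOfDegree

open MonomialOfDegree

theorem theorem2 (d : ℕ) (hd : d ≡ 0 [MOD 2]) : numMaximumIndepSets 4 d = 1 := by
  classical
  have hd : d % 2 = 0 := hd
  have : Fintype (MonomialOfDegree 4 d) := Fintype.ofFinite _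
  let S : Finset (MonomialOfDegree 4 d) := univ.filter IsEquiparity
  have hS : (monomialGraph 4 d).IsIndepSet S := fun u hu v hv _ =>
    not_adj_of_isEquiparity (mem_filter.1 hu).2 (mem_filter.1 hv).2
  have huniq (I : Finset (MonomialOfDegree 4 d)) (hI : (monomialGraph 4 d).IsMaximumIndepSet I) :
      I = S := by
    have hcard : #S ≤ #I := hI.2 S hS
    have hmeet := exists_mem_of_fractional_clique_cover (monomialGraph 4 d) incidentClique
      cliqueWeight incidentClique_injective adj_of_incidentClique_eq cliqueWeight_nonneg
      (sum_cliqueWeight hd) S I (fun v p h => by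
        obtain ⟨s, hs, q, hq⟩ := exists_isEquiparity_of_cliqueWeight_pos hd v p h
        exact ⟨s, by simpa [S] using hs, q, hq⟩) hI.1 hcard
    exact eq_of_subset_of_card_le (fun v hv => by
      simpa [S] using isEquiparity_of_mem hd I hI.1 (mem_of_even_exponents I hI.1 hmeet) v hv) hcard
  obtain ⟨I, hI⟩ := (monomialGraph 4 d).maximumIndepSet_exists
  rw [numMaximumIndepSets, Set.ncard_eq_one]
  refine ⟨S, Set.eq_singleton_iff_unique_mem.2 ⟨?_, huniq⟩⟩
  exact huniq I hI ▸ hI
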